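/- All rings are integral domains. For a domain $R$ with quotient field $\mathrm{qf}(R)$, let $R'$ denote the integral closure of $R$ in $\mathrm{qf}(R)$. A domain $A$ is *valuative* if for each $x\in\mathrm{qf}(A)$ at least one of the extensions $A\subseteq A[x]$, $A\subseteq A[x^{-1}]$ has no ring strictly between its two ends (equality of the two rings is allowed; for $x=0$ only $A\subseteq A[0]=A$ is considered, so the condition holds). A domain $A$ is a *pseudo-valuation domain* if for every prime ideal $P$ of $A$ and all $x,y\in\mathrm{qf}(A)$, $xy\in P$ implies $x\in P$ or $y\in P$. A subring $R$ of a domain $T$ is a *maximal non valuative subring* (resp. *maximal non pseudo-valuation subring*) of $T$ if $R\neq T$, $R$ is not valuative (resp. not a pseudo-valuation domain), and every subring of $T$ properly containing $R$ is valuative (resp. a pseudo-valuation domain). A ring $S$ with $R\subsetneq S\subseteq T$ is *the unique minimal overring of $R$ in $T$* if every ring $A$ with $R\subsetneq A\subseteq T$ contains $S$. **Theorem 2.13.** Let $R$ be a domain that is a maximal non pseudo-valuation subring of $R'$. Then the following are equivalent: (i) $R$ is a maximal non valuative subring of $R'$. (ii) $R$ is not valuative, $R'$ is a valuation domain, and $R$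 has a unique minimal overring $S$ in $R'$, and this $S$ is valuative. -/

import Mathlib

/-- The ring extension `B ⊆ C` of subalgebras of `T` has no ring strictly between `B` and `C`
(equality `B = C` is allowed). -/
def HasNoIntermediateRing {A T : Type*} [CommRing A] [CommRing T] [Algebra A T]
    (B C : Subalgebra A T) : Prop :=
  B ≤ C ∧ ∀ D : Subalgebra A T, B ≤ D → D ≤ C → D = B ∨ D = C

/-- A domain `A` is valuative if for each `x` in its quotient field, at least one of the extensions
`A ⊆ A[x]` and `A ⊆ A[x⁻¹]` has no intermediate ring. -/
def IsValuativeDomain (A : Type*) [CommRing A] [IsDomain A] : Prop :=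
  ∀ x : FractionRing A,
    HasNoIntermediateRing ⊥ (Algebra.adjoin A {x}) ∨
      HasNoIntermediateRing ⊥ (Algebra.adjoin A {x⁻¹})

/-- A domain `A` is a pseudo-valuation domain if, for every prime ideal `P` of `A` and all `x, y`
in the quotient field of `A`, `x * y ∈ P` implies `x ∈ P` or `y ∈ P`. -/
def IsPseudoValuationDomain (A : Type*) [CommRing A] [IsDomain A] : Prop :=
  ∀ P : Ideal A, P.IsPrime → ∀ x y : FractionRing A,
    x * y ∈ algebraMap A (FractionRing A) '' (P : Set A) →
      x ∈ algebraMap A (FractionRing A) '' (P : Set A) ∨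
        y ∈ algebraMap A (FractionRing A) '' (P : Set A)

/-- For an extension of domains `R ⊆ T`: `R` is a proper subring of `T`, `R` is not valuative, and
every subring of `T` properly containing `R` is valuative. The subrings of `T` containing `R` are
the `R`-subalgebras of `T`, with `R` itself being `⊥`. -/
def IsMaximalNonValuativeSubring (R T : Type*) [CommRing R] [IsDomain R] [CommRing T] [IsDomain T]
    [Algebra R T] [FaithfulSMul R T] : Prop :=
  (⊥ : Subalgebra R T) ≠ ⊤ ∧ ¬ IsValuativeDomain R ∧
    ∀ A : Subalgebra R T, ⊥ < A → IsValuativeDomain A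

/-- For an extension of domains `R ⊆ T`: `R` is a proper subring of `T`, `R` is not a
pseudo-valuation domain, and every subring of `T` properly containing `R` is one. -/
def IsMaximalNonPseudoValuationSubring (R T : Type*) [CommRing R] [IsDomain R] [CommRing T]
    [IsDomain T] [Algebra R T] [FaithfulSMul R T] : Prop :=
  (⊥ : Subalgebra R T) ≠ ⊤ ∧ ¬ IsPseudoValuationDomain R ∧
    ∀ A : Subalgebra R T, ⊥ < A → IsPseudoValuationDomain A

/-- `S` is the unique minimal overring of `R` in `T`: `S` properly contains `R`, and every ring `A`
with `R ⊆ A ⊆ T` and `A ≠ R` contains `S`. -/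
def IsUniqueMinimalOverring {R T : Type*} [CommRing R] [CommRing T] [Algebra R T]
    (S : Subalgebra R T) : Prop :=
  ⊥ < S ∧ ∀ A : Subalgebra R T, A ≠ ⊥ → S ≤ A

/-! Write `V` for `R'`. Two facts place its maximal ideal `m`. A pseudo-valuation domain with
integral overring `V` inside its quotient field contains every prime ideal of `V`. Conversely, if
`V` is a valuation domain, any ring `A ⊆ V` with integral extension, the same quotient field and `m
⊆ A` is pseudo-valuation.

(i) ⇒ (ii): `V` is pseudo-valuation, valuative and integrally closed, hence a valuation domain.
Every ring properly between `R` and `V`, and `V` itself, contains `m`, whereas `R` does not; so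
`R[m]` is the unique minimal overring.

(ii) ⇒ (i): valuativity must pass from `S` to each ring `A` with `S ⊆ A ⊆ V`. As `m ⊆ S`, it depends
only on the residue field `V/m`: each of its elements must generate a minimal or trivial extension.
This descends to a statement on algebraic field extensions, `isSimplyMinimal_of_tower`. -/

open Polynomial IntermediateField

/-! ### Minimal simple extensions, element by element -/

/-- Elementwise form of the condition that there is no ring strictly between `A` and `A[x]`. -/
def IsSimplyMinimal (A : Type*) {T : Type*} [CommRing A] [CommRing T] [Algebra A T] (x : T) :
    Prop :=
  ∀ y ∈ Algebra.adjoin A {x}, y ∈ (⊥ : Subalgebra A T) ∨ x ∈ Algebra.adjoin A {y}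

theorem Algebra.mem_adjoin_singleton_self {A T : Type*} [CommRing A] [CommRing T] [Algebra A T]
    (x : T) : x ∈ Algebra.adjoin A {x} :=
  Algebra.subset_adjoin rfl

theorem Algebra.adjoin_singleton_le_iff {A T : Type*} [CommRing A] [CommRing T] [Algebra A T]
    {x : T} {D : Subalgebra A T} : Algebra.adjoin A {x} ≤ D ↔ x ∈ D := by
  rw [Algebra.adjoin_le_iff, Set.singleton_subset_iff, SetLike.mem_coe]

theorem hasNoIntermediateRing_bot_adjoin_iff {A T : Type*} [CommRing A] [CommRing T] [Algebra A T]
    {x : T} : HasNoIntermediateRing ⊥ (Algebra.adjoin A {x}) ↔ IsSimplyMinimal A x := by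
  constructor
  · rintro ⟨-, h⟩ y hy
    rcases h (Algebra.adjoin A {y}) bot_le (Algebra.adjoin_singleton_le_iff.2 hy) with h | h
    · exact Or.inl (h ▸ Algebra.mem_adjoin_singleton_self y)
    · exact Or.inr (h ▸ Algebra.mem_adjoin_singleton_self x)
  · refine fun h => ⟨bot_le, fun D _ hD => ?_⟩
    by_cases hb : D ≤ ⊥
    · exact Or.inl (le_bot_iff.1 hb)
    · obtain ⟨y, hyD, hy⟩ := SetLike.not_le_iff_exists.1 hb
      refine Or.inr (le_antisymm hD (Algebra.adjoin_singleton_le_iff.2 ?_))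
      exact Algebra.adjoin_singleton_le_iff.2 hyD ((h y (hD hyD)).resolve_left hy)

theorem isSimplyMinimal_of_mem_bot {A T : Type*} [CommRing A] [CommRing T] [Algebra A T]
    {x : T} (hx : x ∈ (⊥ : Subalgebra A T)) : IsSimplyMinimal A x :=
  fun _ hy => Or.inl (Algebra.adjoin_singleton_le_iff.2 hx hy)

theorem Algebra.mem_adjoin_of_tower (F : Type*) {L E : Type*} [CommRing F] [CommRing L] [CommRing E]
    [Algebra F L] [Algebra F E] [Algebra L E] [IsScalarTower F L E] {x y : E}
    (h : y ∈ Algebra.adjoin F {x}) : y ∈ Algebra.adjoin L {x} :=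
  (Algebra.adjoin_singleton_le_iff (D := (Algebra.adjoin L {x}).restrictScalars F)).2
    (Algebra.mem_adjoin_singleton_self x) h

theorem Subalgebra.mem_bot_of_tower (F : Type*) {L E : Type*} [CommRing F] [CommRing L] [CommRing E]
    [Algebra F L] [Algebra F E] [Algebra L E] [IsScalarTower F L E] {y : E}
    (h : y ∈ (⊥ : Subalgebra F E)) : y ∈ (⊥ : Subalgebra L E) :=
  (bot_le : ⊥ ≤ (⊥ : Subalgebra L E).restrictScalars F) h

theorem Subalgebra.mem_bot_iff_of_surjective {F L E : Type*} [CommRing F] [CommRing L] [CommRing E]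
    [Algebra F L] [Algebra F E] [Algebra L E] [IsScalarTower F L E]
    (hs : Function.Surjective (algebraMap F L)) {y : E} :
    y ∈ (⊥ : Subalgebra F E) ↔ y ∈ (⊥ : Subalgebra L E) := by
  refine ⟨Subalgebra.mem_bot_of_tower F, fun h => ?_⟩
  obtain ⟨l, rfl⟩ := Algebra.mem_bot.1 h
  obtain ⟨f, rfl⟩ := hs l
  exact Algebra.mem_bot.2 ⟨f, IsScalarTower.algebraMap_apply F L E f⟩

theorem Algebra.mem_adjoin_iff_of_surjective {F L E : Type*} [CommRing F] [CommRing L] [CommRing E]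
    [Algebra F L] [Algebra F E] [Algebra L E] [IsScalarTower F L E]
    (hs : Function.Surjective (algebraMap F L)) {x y : E} :
    y ∈ Algebra.adjoin F {x} ↔ y ∈ Algebra.adjoin L {x} := by
  refine ⟨Algebra.mem_adjoin_of_tower F, fun h => ?_⟩
  induction h using Algebra.adjoin_induction with
  | mem z hz => exact Algebra.subset_adjoin hz
  | algebraMap l =>
    obtain ⟨f, rfl⟩ := hs l
    rw [← IsScalarTower.algebraMap_apply]
    exact Subalgebra.algebraMap_mem _ f
  | add _ _ _ _ ha hb => exact add_mem ha hb
  | mul _ _ _ _ ha hb => exact mul_mem ha hb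

theorem isSimplyMinimal_iff_of_surjective {F L E : Type*} [CommRing F] [CommRing L] [CommRing E]
    [Algebra F L] [Algebra F E] [Algebra L E] [IsScalarTower F L E]
    (hs : Function.Surjective (algebraMap F L)) {x : E} :
    IsSimplyMinimal F x ↔ IsSimplyMinimal L x := by
  simp only [IsSimplyMinimal, Subalgebra.mem_bot_iff_of_surjective hs,
    Algebra.mem_adjoin_iff_of_surjective hs]

/-! ### Algebraic field extensions whose simple subextensions are minimal -/

section Field

variable {F E : Type*} [Field F] [Field E] [Algebra F E]

theorem Algebra.pow_expChar_mem_adjoin (p : ℕ) [ExpChar F p] {x y : E}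
    (h : y ∈ Algebra.adjoin F {x}) : y ^ p ∈ Algebra.adjoin F {x ^ p} := by
  have : ExpChar E p := expChar_of_injective_algebraMap (algebraMap F E).injective p
  induction h using Algebra.adjoin_induction with
  | mem z hz =>
    rw [Set.mem_singleton_iff.1 hz]
    exact Algebra.mem_adjoin_singleton_self _
  | algebraMap l => exact pow_mem (Subalgebra.algebraMap_mem _ l) p
  | add _ _ _ _ ha hb => rw [add_pow_expChar]; exact add_mem ha hb
  | mul _ _ _ _ ha hb => rw [mul_pow]; exact mul_mem ha hb

theorem Algebra.mem_adjoin_pow_expChar_pow (p : ℕ) [ExpChar F p] {x : E}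
    (h : x ∈ Algebra.adjoin F {x ^ p}) (n : ℕ) : x ∈ Algebra.adjoin F {x ^ p ^ n} := by
  have key (n : ℕ) : x ^ p ^ n ∈ Algebra.adjoin F {x ^ p ^ (n + 1)} := by
    induction n with
    | zero => simpa using h
    | succ n ih =>
      have := Algebra.pow_expChar_mem_adjoin p ih
      rwa [← pow_mul, ← pow_mul, ← pow_succ, ← pow_succ] at this
  induction n with
  | zero => simp
  | succ n ih => exact Algebra.adjoin_singleton_le_iff.2 (key n) ih

variable [Algebra.IsAlgebraic F E]

theorem Algebra.mem_adjoin_singleton_iff_mem_adjoin_simple {x y : E} :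
    y ∈ Algebra.adjoin F {x} ↔ y ∈ F⟮x⟯ := by
  rw [← adjoin_simple_toSubalgebra_of_isAlgebraic (Algebra.IsAlgebraic.isAlgebraic (R := F) x)]
  rfl

/-- Some `x ^ p ^ n` is separable, and iterating Frobenius on the hypothesis puts `x` in `F[x ^ p ^
n]`. -/
theorem isSeparable_of_mem_adjoin_pow_expChar (p : ℕ) [ExpChar F p] {x : E}
    (h : x ∈ Algebra.adjoin F {x ^ p}) : IsSeparable F x := by
  obtain ⟨n, y, hy⟩ := IsPurelyInseparable.pow_mem (separableClosure F E) p x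
  have hs : x ^ p ^ n ∈ separableClosure F E := hy ▸ y.2
  rw [← mem_separableClosure_iff]
  exact (Algebra.adjoin_singleton_le_iff (D := (separableClosure F E).toSubalgebra)).2 hs
    (Algebra.mem_adjoin_pow_expChar_pow p h n)

theorem IsSimplyMinimal.isSeparable_or_pow_expChar_mem {x : E} (h : IsSimplyMinimal F x)
    (p : ℕ) [ExpChar F p] : IsSeparable F x ∨ x ^ p ∈ (⊥ : Subalgebra F E) :=
  ((h (x ^ p) (pow_mem (Algebra.mem_adjoin_singleton_self x) p)).imp id
    (isSeparable_of_mem_adjoin_pow_expChar p)).symm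

/-- It is enough to find `z` with `x ∈ F[z]` such that `z ∈ F[x]` forces `y ∈ F[x]`: minimality of
`F[z]` then gives `F[x] = F[z]`. If `y` is separable, a primitive element of `F(x, y)` serves. -/
theorem adjoin_eq_top_of_isSeparable_of_isSimplyMinimal (h : ∀ x : E, IsSimplyMinimal F x) {x : E}
    (hx : IsSeparable F x) (hxF : x ∉ (⊥ : Subalgebra F E)) (y : E) :
    y ∈ Algebra.adjoin F {x} := by
  suffices ∃ z, x ∈ Algebra.adjoin F {z} ∧ (z ∈ Algebra.adjoin F {x} → y ∈ Algebra.adjoin F {x}) by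
    obtain ⟨z, hxz, hzy⟩ := this
    exact hzy ((h z x hxz).resolve_left hxF)
  let p := ringExpChar F
  have : ExpChar E p := expChar_of_injective_algebraMap (algebraMap F E).injective p
  rcases (h y).isSeparable_or_pow_expChar_mem p with hy | hy
  · have : Algebra.IsSeparable F F⟮x, y⟯ := by
      rw [isSeparable_adjoin_iff_isSeparable]
      rintro z (rfl | rfl) <;> assumption
    have : FiniteDimensional F F⟮x, y⟯ :=
      finiteDimensional_adjoin fun z _ => Algebra.IsIntegral.isIntegral z
    obtain ⟨z, hz⟩ := Field.exists_primitive_element F F⟮x, y⟯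
    have hz' : F⟮(z : E)⟯ = F⟮x, y⟯ := by
      have := congrArg lift hz
      rwa [lift_adjoin_simple, lift_top] at this
    have hxz : x ∈ F⟮(z : E)⟯ := hz'.ge (subset_adjoin F _ (by simp))
    have hyz : y ∈ F⟮(z : E)⟯ := hz'.ge (subset_adjoin F _ (by simp))
    rw [← Algebra.mem_adjoin_singleton_iff_mem_adjoin_simple] at hxz hyz
    exact ⟨z, hxz, fun hzx => Algebra.adjoin_singleton_le_iff.2 hzx hyz⟩
  -- Here `y ^ p ∈ F`, so `F[x + y]` contains `x ^ p`, and with it the separable element `x`.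
  · refine ⟨x + y, ?_, fun hz => ?_⟩
    · have hxp : x ^ p ∈ Algebra.adjoin F {x + y} := by
        have : x ^ p = (x + y) ^ p - y ^ p := by rw [add_pow_expChar, add_sub_cancel_right]
        rw [this]
        exact sub_mem (pow_mem (Algebra.mem_adjoin_singleton_self _) p)
          ((bot_le : ⊥ ≤ Algebra.adjoin F {x + y}) hy)
      have hxx : x ∈ Algebra.adjoin F {x ^ p} := by
        rw [Algebra.mem_adjoin_singleton_iff_mem_adjoin_simple,
          ← adjoin_simple_eq_adjoin_pow_expChar_of_isSeparable F E hx p]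
        exact mem_adjoin_simple_self F x
      exact Algebra.adjoin_singleton_le_iff.2 hxp hxx
    · simpa using sub_mem hz (Algebra.mem_adjoin_singleton_self x)

/-- Every element outside `F` has degree exactly `p`, so nested simple extensions by such elements
coincide. -/
theorem isSimplyMinimal_of_forall_pow_mem {p : ℕ} [hp : ExpChar F p]
    (h : ∀ x : E, x ^ p ∈ (⊥ : Subalgebra F E)) (x : E) : IsSimplyMinimal F x := by
  have : ExpChar E p := expChar_of_injective_algebraMap (algebraMap F E).injective p
  have hfin (z : E) (hz : z ∉ (⊥ : Subalgebra F E)) : Module.finrank F F⟮z⟯ = p := by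
    obtain ⟨a, ha⟩ := Algebra.mem_bot.1 (h z)
    have hprime : p.Prime := by
      rcases hp with _ | hp
      · exact absurd (by simpa using h z) hz
      · exact hp
    have hirr : Irreducible (X ^ p - C a : F[X]) := by
      refine X_pow_sub_C_irreducible_of_prime hprime fun b hb => hz ?_
      refine Algebra.mem_bot.2 ⟨b, frobenius_inj E p ?_⟩
      rw [frobenius_def, frobenius_def, ← ha, ← hb, map_pow]
    rw [adjoin.finrank (Algebra.IsIntegral.isIntegral z),
      ← minpoly.eq_of_irreducible_of_monic hirr (by simp [ha])
        (monic_X_pow_sub_C a hprime.ne_zero), natDegree_X_pow_sub_C]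
  intro y hy
  refine or_iff_not_imp_left.2 fun hyF => ?_
  have hxF : x ∉ (⊥ : Subalgebra F E) := fun hx => hyF (Algebra.adjoin_singleton_le_iff.2 hx hy)
  have : FiniteDimensional F F⟮x⟯ := adjoin.finiteDimensional (Algebra.IsIntegral.isIntegral x)
  rw [Algebra.mem_adjoin_singleton_iff_mem_adjoin_simple] at hy ⊢
  rw [eq_of_le_of_finrank_eq (adjoin_simple_le_iff.2 hy) ((hfin y hyF).trans (hfin x hxF).symm)]
  exact mem_adjoin_simple_self F x

/-- If some separable `s` lies outside `F`, then `E = F[s]` and any `l ∈ L` outside `F` generates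
`E`, so `L` is `F` or `E`. Otherwise every `p`-th power lies in `F`, hence in `L`. -/
theorem isSimplyMinimal_of_tower {L : Type*} [Field L] [Algebra F L] [Algebra L E]
    [IsScalarTower F L E] (h : ∀ x : E, IsSimplyMinimal F x) (x : E) : IsSimplyMinimal L x := by
  have : Algebra.IsAlgebraic L E := Algebra.IsAlgebraic.tower_top (K := F) L
  by_cases hsep : ∃ s : E, IsSeparable F s ∧ s ∉ (⊥ : Subalgebra F E)
  · obtain ⟨s, hs, hsF⟩ := hsep
    have htop := adjoin_eq_top_of_isSeparable_of_isSimplyMinimal h hs hsF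
    by_cases hL : Function.Surjective (algebraMap F L)
    · exact (isSimplyMinimal_iff_of_surjective hL).1 (h x)
    · obtain ⟨l, hl⟩ := not_forall.1 hL
      have hlF : algebraMap L E l ∉ (⊥ : Subalgebra F E) := by
        rintro ⟨f, hf⟩
        exact hl ⟨f, (algebraMap L E).injective
          ((IsScalarTower.algebraMap_apply F L E f).symm.trans hf)⟩
      have hsl := (h s _ (htop (algebraMap L E l))).resolve_left hlF
      refine isSimplyMinimal_of_mem_bot ?_
      exact Algebra.adjoin_singleton_le_iff.2 (Subalgebra.algebraMap_mem ⊥ l)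
        (Algebra.mem_adjoin_of_tower (L := L) F (Algebra.adjoin_singleton_le_iff.2 hsl (htop x)))
  · push Not at hsep
    have : ExpChar L (ringExpChar F) :=
      expChar_of_injective_algebraMap (algebraMap F L).injective (ringExpChar F)
    refine isSimplyMinimal_of_forall_pow_mem (p := ringExpChar F) (fun y => ?_) x
    refine Subalgebra.mem_bot_of_tower F ?_
    rcases (h y).isSeparable_or_pow_expChar_mem (ringExpChar F) with hy | hy
    · exact pow_mem (hsep y hy) _
    · exact hy

end Field

/-! ### Transfer along homomorphisms and to integral extensions -/

/-- The kernel lies in every subalgebra, so membership in a subalgebra can be tested after applying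
`f`. -/
theorem isSimplyMinimal_map_iff_of_ker_le_bot {A T T' : Type*} [CommRing A] [CommRing T]
    [CommRing T'] [Algebra A T] [Algebra A T'] {f : T →ₐ[A] T'}
    (hf : ∀ x, f x = 0 → x ∈ (⊥ : Subalgebra A T)) {x : T} :
    IsSimplyMinimal A (f x) ↔ IsSimplyMinimal A x := by
  have hmem (D : Subalgebra A T) (y : T) : f y ∈ D.map f ↔ y ∈ D := by
    refine ⟨fun ⟨z, hz, hzy⟩ => ?_, fun h => ⟨y, h, rfl⟩⟩
    have hyz : y - z ∈ (⊥ : Subalgebra A T) := hf _ (by rw [map_sub, sub_eq_zero]; exact hzy.symm)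
    simpa using add_mem ((bot_le : ⊥ ≤ D) hyz) hz
  have hbot (y : T) : f y ∈ (⊥ : Subalgebra A T') ↔ y ∈ (⊥ : Subalgebra A T) := by
    rw [← Algebra.map_bot f, hmem]
  have hadj (y z : T) : f y ∈ Algebra.adjoin A {f z} ↔ y ∈ Algebra.adjoin A {z} := by
    rw [← AlgHom.map_adjoin_singleton, hmem]
  constructor
  · intro h y hy
    simpa only [hbot, hadj] using h (f y) ((hadj y x).2 hy)
  · intro h y hy
    obtain ⟨z, hz, rfl⟩ : y ∈ (Algebra.adjoin A {x}).map f := by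
      rwa [AlgHom.map_adjoin_singleton]
    exact (h z hz).imp (hbot z).2 (hadj x z).2

theorem isSimplyMinimal_map_iff_of_injective {A T T' : Type*} [CommRing A] [CommRing T]
    [CommRing T'] [Algebra A T] [Algebra A T'] {f : T →ₐ[A] T'} (hf : Function.Injective f) {x : T} :
    IsSimplyMinimal A (f x) ↔ IsSimplyMinimal A x :=
  isSimplyMinimal_map_iff_of_ker_le_bot fun _ hy =>
    (map_eq_zero_iff f hf).1 hy ▸ zero_mem _

theorem Algebra.inv_mem_adjoin_singleton {F E : Type*} [CommRing F] [Field E] [Algebra F E]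
    [Algebra.IsIntegral F E] (x : E) : x⁻¹ ∈ Algebra.adjoin F {x} := by
  rcases eq_or_ne x 0 with rfl | hx
  · simp
  have : Algebra.IsIntegral (Algebra.adjoin F {x}) E := Algebra.IsIntegral.tower_top F
  have hfield := isField_of_isIntegral_of_isField (R := Algebra.adjoin F {x}) (S := E)
    Subtype.val_injective (Field.toIsField E)
  obtain ⟨y, hy⟩ := hfield.mul_inv_cancel
    (a := ⟨x, Algebra.mem_adjoin_singleton_self x⟩) fun h => hx (congrArg Subtype.val h)
  exact inv_eq_of_mul_eq_one_right (congrArg Subtype.val hy) ▸ y.2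

/-- The images of `F` and `L` in `E` are fields because `E` is a field integral over them. -/
theorem isSimplyMinimal_of_isIntegral_tower {F L E : Type*} [CommRing F] [CommRing L] [Field E]
    [Algebra F L] [Algebra F E] [Algebra L E] [IsScalarTower F L E] [Algebra.IsIntegral F E]
    (h : ∀ x : E, IsSimplyMinimal F x) (x : E) : IsSimplyMinimal L x := by
  let F' : Subalgebra F E := ⊥
  let L' : Subalgebra L E := ⊥
  have : Algebra.IsIntegral L E := Algebra.IsIntegral.tower_top F
  have : Algebra.IsIntegral F' E := Algebra.IsIntegral.tower_top F
  have : Algebra.IsIntegral L' E := Algebra.IsIntegral.tower_top L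
  let _ : Field F' := (isField_of_isIntegral_of_isField (R := F') (S := E)
    Subtype.val_injective (Field.toIsField E)).toField
  let _ : Field L' := (isField_of_isIntegral_of_isField (R := L') (S := E)
    Subtype.val_injective (Field.toIsField E)).toField
  have hle : F' ≤ L'.restrictScalars F := bot_le
  let _ : Algebra F' L' := (Subalgebra.inclusion hle).toRingHom.toAlgebra
  have : IsScalarTower F' L' E := IsScalarTower.of_algebraMap_eq fun _ => rfl
  have hF : Function.Surjective (algebraMap F F') := by
    rintro ⟨_, a, rfl⟩
    exact ⟨a, rfl⟩
  have hL : Function.Surjective (algebraMap L L') := by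
    rintro ⟨_, a, rfl⟩
    exact ⟨a, rfl⟩
  have : Algebra.IsAlgebraic F' E := Algebra.IsIntegral.isAlgebraic
  exact (isSimplyMinimal_iff_of_surjective hL).2 (isSimplyMinimal_of_tower
    (fun y => (isSimplyMinimal_iff_of_surjective hF).1 (h y)) x)

/-! ### Pseudo-valuation domains inside their quotient field -/

section FractionField

variable {A : Type*} (K : Type*) [CommRing A] [IsDomain A] [Field K] [Algebra A K]
  [IsFractionRing A K]

theorem isValuativeDomain_iff : IsValuativeDomain A ↔
    ∀ x : K, IsSimplyMinimal A x ∨ IsSimplyMinimal A x⁻¹ := by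
  let e := FractionRing.algEquiv A K
  have h (x : FractionRing A) : IsSimplyMinimal A (e x) ↔ IsSimplyMinimal A x :=
    isSimplyMinimal_map_iff_of_injective (f := e.toAlgHom) e.injective
  unfold IsValuativeDomain
  rw [← e.toEquiv.forall_congr_right]
  refine forall_congr' fun x => ?_
  rw [hasNoIntermediateRing_bot_adjoin_iff, hasNoIntermediateRing_bot_adjoin_iff, ← h, ← h,
    map_inv₀]
  rfl

theorem isPseudoValuationDomain_iff : IsPseudoValuationDomain A ↔
    ∀ P : Ideal A, P.IsPrime → ∀ x y : K, x * y ∈ algebraMap A K '' (P : Set A) →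
      x ∈ algebraMap A K '' (P : Set A) ∨ y ∈ algebraMap A K '' (P : Set A) := by
  let e := FractionRing.algEquiv A K
  have h (P : Ideal A) (x : FractionRing A) :
      e x ∈ algebraMap A K '' (P : Set A) ↔ x ∈ algebraMap A (FractionRing A) '' (P : Set A) := by
    simp only [Set.mem_image, ← e.commutes, e.injective.eq_iff]
  unfold IsPseudoValuationDomain
  refine forall_congr' fun P => forall_congr' fun _ => ?_
  rw [← e.toEquiv.forall_congr_right]
  refine forall_congr' fun x => ?_
  rw [← e.toEquiv.forall_congr_right]
  refine forall_congr' fun y => ?_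
  rw [← h, ← h, ← h, map_mul]
  rfl

variable {K}

/-- The ring is local: for a second maximal ideal `N` containing `a` and `b ∈ M \ N`, the product
`(a / b) * b ∈ N` violates the defining property. -/
theorem IsPseudoValuationDomain.isUnit_of_notMem_isMaximal (hA : IsPseudoValuationDomain A)
    {M : Ideal A} (hM : M.IsMaximal) {a : A} (ha : a ∉ M) : IsUnit a := by
  by_contra hu
  obtain ⟨N, hN, haN⟩ := exists_max_ideal_of_mem_nonunits hu
  have hMN : ¬ M ≤ N := fun h => ha (hM.eq_of_le hN.ne_top h ▸ haN)
  obtain ⟨b, hbM, hbN⟩ := SetLike.not_le_iff_exists.1 hMN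
  have hb : algebraMap A (FractionRing A) b ≠ 0 := by
    rw [Ne, IsFractionRing.to_map_eq_zero_iff]
    rintro rfl
    exact hbN N.zero_mem
  rcases hA N hN.isPrime (algebraMap A _ a / algebraMap A _ b) (algebraMap A _ b)
    ⟨a, haN, (div_mul_cancel₀ _ hb).symm⟩ with ⟨c, -, hc⟩ | ⟨c, hcN, hc⟩
  · refine ha ?_
    rw [eq_div_iff hb, ← map_mul] at hc
    exact IsFractionRing.injective A (FractionRing A) hc ▸ M.mul_mem_left c hbM
  · exact hbN (IsFractionRing.injective A (FractionRing A) hc ▸ hcN)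

theorem IsPseudoValuationDomain.mul_mem (hA : IsPseudoValuationDomain A) {P : Ideal A}
    (hP : P.IsPrime) {x : K} (hx : x⁻¹ ∉ (⊥ : Subalgebra A K)) {a : A} (ha : a ∈ P) :
    ∃ b ∈ P, algebraMap A K b = x * algebraMap A K a := by
  have hx0 : x ≠ 0 := by
    rintro rfl
    exact hx (by simp)
  refine ((isPseudoValuationDomain_iff K).1 hA P hP x⁻¹ (x * algebraMap A K a) ?_).resolve_left ?_
  · exact ⟨a, ha, by rw [inv_mul_cancel_left₀ hx0]⟩
  · rintro ⟨b, -, hb⟩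
    exact hx (Algebra.mem_bot.2 ⟨b, hb⟩)

theorem IsPseudoValuationDomain.pow_mul_mem (hA : IsPseudoValuationDomain A) {P : Ideal A}
    (hP : P.IsPrime) {x : K} (hx : x⁻¹ ∉ (⊥ : Subalgebra A K)) {a : A} (ha : a ∈ P) (n : ℕ) :
    ∃ b ∈ P, algebraMap A K b = x ^ n * algebraMap A K a := by
  induction n with
  | zero => exact ⟨a, ha, by simp⟩
  | succ n ih =>
    obtain ⟨b, hb, hab⟩ := ih
    obtain ⟨c, hc, hbc⟩ := hA.mul_mem hP hx hb
    exact ⟨c, hc, by rw [hbc, hab, pow_succ', mul_assoc]⟩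

/-- A leading coefficient in `M` makes the leading term's value at `x` an element of `A`, to be
absorbed into the constant term; one outside `M` is a unit and can be normalized to 1. -/
theorem IsPseudoValuationDomain.isIntegral_of_aeval_eq_zero (hA : IsPseudoValuationDomain A)
    {M : Ideal A} (hM : M.IsMaximal) {x : K} (hx : x⁻¹ ∉ (⊥ : Subalgebra A K)) {n : ℕ} {f : A[X]}
    (hn : f.natDegree ≤ n) (hf : f.coeff 1 ∉ M) (hfx : aeval x f = 0) : IsIntegral A x := by
  induction n generalizing f with
  | zero =>
    rw [coeff_eq_zero_of_natDegree_lt (by omega)] at hf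
    exact absurd M.zero_mem hf
  | succ n ih =>
    by_cases hc : f.coeff (n + 1) ∈ M
    · obtain ⟨b, -, hb⟩ := hA.pow_mul_mem hM.isPrime hx hc (n + 1)
      -- The linear term is never the one removed, so the descent stops at degree 1 at the latest.
      have hn0 : n ≠ 0 := by
        rintro rfl
        exact hf hc
      refine ih (f := f - C (f.coeff (n + 1)) * X ^ (n + 1) + C b) ?_ ?_ ?_
      · rw [natDegree_le_iff_coeff_eq_zero]
        intro k hk
        rcases (Nat.succ_le_iff.2 hk).eq_or_lt with rfl | hk'
        · simp
        · have hk0 : k ≠ 0 := by omega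
          have hk1 : k ≠ n + 1 := by omega
          have hfk := coeff_eq_zero_of_natDegree_lt (p := f) (n := k) (by omega)
          rw [coeff_add, coeff_sub, coeff_C_mul, coeff_X_pow, if_neg hk1, coeff_C, if_neg hk0, hfk,
            mul_zero, sub_zero, add_zero]
      · simpa [coeff_C, coeff_X_pow, hn0] using hf
      · rw [map_add, map_sub, hfx, map_mul, aeval_C, map_pow, aeval_X, aeval_C, hb]
        ring
    · obtain ⟨u, hu⟩ := hA.isUnit_of_notMem_isMaximal hM hc
      have hdeg : f.natDegree = n + 1 :=
        le_antisymm hn (le_natDegree_of_ne_zero fun h => hc (h ▸ M.zero_mem))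
      refine ⟨C (↑u⁻¹ : A) * f, monic_C_mul_of_mul_leadingCoeff_eq_one ?_, ?_⟩
      · rw [leadingCoeff, hdeg, ← hu, Units.inv_mul]
      · rw [← aeval_def, map_mul, hfx, mul_zero]

/-- Minimality tested on `x ^ 2` gives either `x ^ 2 ∈ A` or `x = g(x ^ 2)`; in the latter case `X -
g(X ^ 2)` has linear coefficient 1. -/
theorem IsPseudoValuationDomain.mem_bot_or_inv_mem_bot [IsIntegrallyClosed A]
    (hA : IsPseudoValuationDomain A) {x : K} (hx : IsSimplyMinimal A x) :
    x ∈ (⊥ : Subalgebra A K) ∨ x⁻¹ ∈ (⊥ : Subalgebra A K) := by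
  refine or_iff_not_imp_right.2 fun hxi => ?_
  suffices IsIntegral A x from Algebra.mem_bot.2 (IsIntegrallyClosed.isIntegral_iff.1 this)
  rcases hx (x ^ 2) (pow_mem (Algebra.mem_adjoin_singleton_self x) 2) with h | h
  · obtain ⟨a, ha⟩ := Algebra.mem_bot.1 h
    exact IsIntegral.of_pow two_pos (ha ▸ isIntegral_algebraMap)
  · rw [Algebra.adjoin_singleton_eq_range_aeval] at h
    obtain ⟨g, hg⟩ := h
    obtain ⟨M, hM⟩ := Ideal.exists_maximal A
    refine hA.isIntegral_of_aeval_eq_zero hM hxi (f := X - expand A 2 g) le_rfl ?_ ?_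
    · rw [coeff_sub, coeff_expand two_pos]
      simpa using hM.isPrime.one_notMem
    · rw [map_sub, aeval_X, expand_aeval]
      exact sub_eq_zero.2 hg.symm

theorem IsPseudoValuationDomain.valuationRing_of_isValuativeDomain [IsIntegrallyClosed A]
    (hA : IsPseudoValuationDomain A) (hv : IsValuativeDomain A) : ValuationRing A := by
  rw [ValuationRing.iff_isInteger_or_isInteger A (FractionRing A)]
  intro x
  change x ∈ (⊥ : Subalgebra A (FractionRing A)) ∨ x⁻¹ ∈ (⊥ : Subalgebra A (FractionRing A))
  rcases (isValuativeDomain_iff (FractionRing A)).1 hv x with h | h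
  · exact hA.mem_bot_or_inv_mem_bot h
  · simpa [or_comm] using hA.mem_bot_or_inv_mem_bot h

end FractionField

/-! ### Integral overrings and the residue field of a valuation overring -/

section Extension

variable {A V : Type*} [CommRing A] [IsDomain A] [CommRing V] [IsDomain V] [Algebra A V]

/-- Suppose `v ∈ Q` is not in `A`. The constant term `c` of a monic equation of `v` lies in `Q ∩ A`,
and `v⁻¹ (Q ∩ A) ⊆ Q ∩ A`, so dividing by `v` keeps `c / v` in `A` and lowers the degree. Degree 1
gives `v ∈ A`. -/
theorem IsPseudoValuationDomain.mem_bot_of_mem_isPrime (K : Type*) [Field K] [Algebra V K] [Algebra A K]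
    [IsScalarTower A V K] [IsFractionRing A K] [IsFractionRing V K] [Algebra.IsIntegral A V]
    (hA : IsPseudoValuationDomain A) {Q : Ideal V} (hQ : Q.IsPrime) {v : V} (hv : v ∈ Q) :
    v ∈ (⊥ : Subalgebra A V) := by
  by_contra hvA
  have hv0 : v ≠ 0 := fun h => hvA (h ▸ zero_mem _)
  have hvK : (algebraMap V K v)⁻¹⁻¹ ∉ (⊥ : Subalgebra A K) := by
    rw [inv_inv]
    rintro ⟨a, ha⟩
    refine hvA (Algebra.mem_bot.2 ⟨a, IsFractionRing.injective V K ?_⟩)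
    exact (IsScalarTower.algebraMap_apply A V K a).symm.trans ha
  have key (n : ℕ) (f : A[X]) (hf : f.Monic) (hn : f.natDegree = n + 1) (hfv : aeval v f = 0) :
      False := by
    induction n generalizing f with
    | zero =>
      rw [hf.eq_X_add_C hn] at hfv
      refine hvA (Algebra.mem_bot.2 ⟨-f.coeff 0, ?_⟩)
      rw [map_neg, neg_eq_iff_add_eq_zero, add_comm]
      simpa using hfv
    | succ n ih =>
      have hfv' : aeval v f.divX * v + algebraMap A V (f.coeff 0) = 0 := by
        rw [← hfv]
        conv_rhs => rw [← divX_mul_X_add f]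
        simp
      have ha : f.coeff 0 ∈ Q.comap (algebraMap A V) := by
        rw [Ideal.mem_comap, ← neg_eq_iff_add_eq_zero.2 hfv', Q.neg_mem_iff]
        exact Q.mul_mem_left _ hv
      obtain ⟨b, -, hb⟩ := hA.mul_mem (hQ.comap _) hvK ha
      have hbv : algebraMap A V b * v = algebraMap A V (f.coeff 0) := by
        apply IsFractionRing.injective V K
        rw [map_mul, ← IsScalarTower.algebraMap_apply, ← IsScalarTower.algebraMap_apply, hb,
          mul_right_comm, inv_mul_cancel₀, one_mul]
        simpa using hv0
      have hdeg : (f.divX + C b).natDegree = n + 1 := by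
        rw [natDegree_add_C, natDegree_divX_eq_natDegree_tsub_one, hn, Nat.add_sub_cancel]
      refine ih (f.divX + C b) (monic_of_natDegree_le_of_coeff_eq_one (n + 1) hdeg.le ?_) hdeg ?_
      · have := hf.coeff_natDegree
        rw [hn] at this
        simpa [coeff_C] using this
      · rw [← mul_left_inj' hv0, zero_mul, ← hfv', map_add, add_mul, aeval_C, hbv]
  obtain ⟨f, hf, hfv⟩ := Algebra.IsIntegral.isIntegral (R := A) v
  have hdeg : f.natDegree ≠ 0 := by
    intro h
    rw [hf.natDegree_eq_zero.1 h] at hfv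
    simp at hfv
  exact key (f.natDegree - 1) f hf (by omega) hfv

variable [ValuationRing V]

theorem ValuationRing.exists_mem_maximalIdeal_or_exists_mul_eq_one {K : Type*} [Field K]
    [Algebra V K] [IsFractionRing V K] (x : K) :
    (∃ v ∈ IsLocalRing.maximalIdeal V, algebraMap V K v = x) ∨
      ∃ w : V, algebraMap V K w * x = 1 := by
  by_cases hx0 : x = 0
  · exact Or.inl ⟨0, zero_mem _, by simp [hx0]⟩
  rcases ValuationRing.isInteger_or_isInteger V x with ⟨v, rfl⟩ | ⟨w, hw⟩
  · by_cases hv : IsUnit v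
    · obtain ⟨w, hw⟩ := hv.exists_left_inv
      exact Or.inr ⟨w, by rw [← map_mul, hw, map_one]⟩
    · exact Or.inl ⟨v, hv, rfl⟩
  · exact Or.inr ⟨w, by rw [hw, inv_mul_cancel₀ hx0]⟩

theorem isPseudoValuationDomain_of_maximalIdeal_le (K : Type*) [Field K] [Algebra V K] [Algebra A K]
    [IsScalarTower A V K] [IsFractionRing A K] [IsFractionRing V K] [Algebra.IsIntegral A V]
    (h : ∀ v ∈ IsLocalRing.maximalIdeal V, v ∈ (⊥ : Subalgebra A V)) :
    IsPseudoValuationDomain A := by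
  have hinj : Function.Injective (algebraMap A K) := IsFractionRing.injective A K
  have : FaithfulSMul A V := by
    rw [faithfulSMul_iff_algebraMap_injective]
    refine Function.Injective.of_comp (f := algebraMap V K) ?_
    rwa [← RingHom.coe_comp, ← IsScalarTower.algebraMap_eq]
  rw [isPseudoValuationDomain_iff K]
  intro P hP
  -- Integral extensions reflect units.
  have hPV {p : A} (hp : p ∈ P) : algebraMap A V p ∈ IsLocalRing.maximalIdeal V := by
    intro hu
    exact hP.ne_top (P.eq_top_of_isUnit_mem hp (isUnit_of_map_unit (algebraMap A V) p hu))
  have hVA {v : V} (hv : v ∈ IsLocalRing.maximalIdeal V) :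
      ∃ a : A, algebraMap A K a = algebraMap V K v := by
    obtain ⟨a, ha⟩ := Algebra.mem_bot.1 (h v hv)
    exact ⟨a, by rw [IsScalarTower.algebraMap_apply A V K, ha]⟩
  have key (v : V) (hv : v ∈ IsLocalRing.maximalIdeal V) (y : K)
      (hvy : algebraMap V K v * y ∈ algebraMap A K '' (P : Set A)) :
      algebraMap V K v ∈ algebraMap A K '' (P : Set A) ∨ y ∈ algebraMap A K '' (P : Set A) := by
    obtain ⟨p, hp, hpy⟩ := hvy
    obtain ⟨a, ha⟩ := hVA hv
    rcases ValuationRing.exists_mem_maximalIdeal_or_exists_mul_eq_one (V := V) y with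
      ⟨w, hw, rfl⟩ | ⟨w, hw⟩
    · obtain ⟨b, hb⟩ := hVA hw
      have hab : a * b = p := hinj (by rw [map_mul, ha, hb, hpy])
      exact (hP.mem_or_mem (hab ▸ hp)).imp (fun h => ⟨a, h, ha⟩) (fun h => ⟨b, h, hb⟩)
    · obtain ⟨b, hb⟩ := hVA (Ideal.mul_mem_right (w ^ 2) _ (hPV hp))
      -- With `w = y⁻¹` and `p = v * y`, `v ^ 2 = (p * w ^ 2) * p`, whose first factor is in the
      -- maximal ideal of `V`, hence in `A`.
      refine Or.inl ⟨a, hP.mem_of_pow_mem 2 ?_, ha⟩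
      suffices a ^ 2 = b * p from this ▸ P.mul_mem_left b hp
      apply hinj
      rw [map_pow, map_mul, hb, ha, map_mul, ← IsScalarTower.algebraMap_apply, hpy, map_pow]
      linear_combination (-(algebraMap V K v) ^ 2 * (algebraMap V K w * y + 1)) * hw
  intro x y hxy
  rcases ValuationRing.exists_mem_maximalIdeal_or_exists_mul_eq_one (V := V) x with
    ⟨v, hv, rfl⟩ | ⟨v, hv⟩
  · exact key v hv y hxy
  rcases ValuationRing.exists_mem_maximalIdeal_or_exists_mul_eq_one (V := V) y with
    ⟨w, hw, rfl⟩ | ⟨w, hw⟩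
  · exact (key w hw x (mul_comm x _ ▸ hxy)).symm
  · obtain ⟨p, hp, hpxy⟩ := hxy
    refine absurd (IsUnit.of_mul_eq_one (b := v * w) (a := algebraMap A V p) ?_) (hPV hp)
    apply IsFractionRing.injective V K
    rw [map_mul, ← IsScalarTower.algebraMap_apply, hpxy, map_mul, map_one]
    linear_combination algebraMap V K w * y * hv + hw

/-- Elements of the maximal ideal are in `A`, and any other `x` has `x⁻¹ ∈ V`, so only elements of
`V` matter, modulo that ideal. In the residue field, integral over `A`, an element and its inverse
generate the same subring, so the choice between them disappears. -/
theorem isValuativeDomain_iff_residueField (K : Type*) [Field K] [Algebra V K] [Algebra A K]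
    [IsScalarTower A V K] [IsFractionRing A K] [IsFractionRing V K] [Algebra.IsIntegral A V]
    (h : ∀ v ∈ IsLocalRing.maximalIdeal V, v ∈ (⊥ : Subalgebra A V)) :
    IsValuativeDomain A ↔ ∀ x : IsLocalRing.ResidueField V, IsSimplyMinimal A x := by
  have hK (v : V) : IsSimplyMinimal A (algebraMap V K v) ↔ IsSimplyMinimal A v :=
    isSimplyMinimal_map_iff_of_injective (f := IsScalarTower.toAlgHom A V K)
      (IsFractionRing.injective V K)
  have hk (v : V) : IsSimplyMinimal A (IsLocalRing.residue V v) ↔ IsSimplyMinimal A v :=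
    isSimplyMinimal_map_iff_of_ker_le_bot
      (f := IsScalarTower.toAlgHom A V (IsLocalRing.ResidueField V))
      fun v hv => h v ((IsLocalRing.residue_eq_zero_iff v).1 hv)
  rw [isValuativeDomain_iff K]
  constructor
  · intro hA x
    obtain ⟨v, rfl⟩ := IsLocalRing.residue_surjective x
    by_cases hv : v ∈ IsLocalRing.maximalIdeal V
    · exact (hk v).2 (isSimplyMinimal_of_mem_bot (h v hv))
    obtain ⟨w, hw⟩ := (IsLocalRing.notMem_maximalIdeal.1 hv).exists_left_inv
    rcases hA (algebraMap V K v) with h | h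
    · exact (hk v).2 ((hK v).1 h)
    · have hwv : (algebraMap V K v)⁻¹ = algebraMap V K w :=
        inv_eq_of_mul_eq_one_left (by rw [← map_mul, hw, map_one])
      rw [hwv, hK, ← hk] at h
      have hwv' : IsLocalRing.residue V w = (IsLocalRing.residue V v)⁻¹ :=
        eq_inv_of_mul_eq_one_left (by rw [← map_mul, hw, map_one])
      rw [hwv'] at h
      have : Algebra.IsIntegral A (IsLocalRing.ResidueField V) :=
        Algebra.IsIntegral.of_surjective
          (IsScalarTower.toAlgHom A V (IsLocalRing.ResidueField V)) IsLocalRing.residue_surjective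
      have hinv (a : IsLocalRing.ResidueField V) : a⁻¹ ∈ Algebra.adjoin A {a} :=
        Algebra.inv_mem_adjoin_singleton a
      intro y hy
      have hvv := hinv (IsLocalRing.residue V v)⁻¹
      rw [inv_inv] at hvv
      refine (h y (Algebra.adjoin_singleton_le_iff.2 hvv hy)).imp_right fun hvy => ?_
      exact Algebra.adjoin_singleton_le_iff.2 hvy hvv
  · intro hA x
    rcases ValuationRing.exists_mem_maximalIdeal_or_exists_mul_eq_one (V := V) x with
      ⟨v, hv, rfl⟩ | ⟨w, hw⟩
    · exact Or.inl ((hK v).2 (isSimplyMinimal_of_mem_bot (h v hv)))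
    · rw [← eq_inv_of_mul_eq_one_left hw]
      exact Or.inr ((hK w).2 ((hk w).1 (hA _)))

theorem IsValuativeDomain.of_tower (K : Type*) [Field K] [Algebra V K] [Algebra A K]
    [IsScalarTower A V K] [IsFractionRing A K] [IsFractionRing V K]
    {S : Type*} [CommRing S] [IsDomain S] [Algebra S A] [Algebra S V]
    [Algebra S K] [IsScalarTower S A V] [IsScalarTower S V K] [IsFractionRing S K]
    [Algebra.IsIntegral S V] (hS : IsValuativeDomain S)
    (h : ∀ v ∈ IsLocalRing.maximalIdeal V, v ∈ (⊥ : Subalgebra S V)) : IsValuativeDomain A := by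
  have : Algebra.IsIntegral A V := Algebra.IsIntegral.tower_top S
  have : IsScalarTower S A (IsLocalRing.ResidueField V) := IsScalarTower.of_algebraMap_eq fun s => by
    rw [IsScalarTower.algebraMap_apply S V (IsLocalRing.ResidueField V),
      IsScalarTower.algebraMap_apply A V (IsLocalRing.ResidueField V),
      ← IsScalarTower.algebraMap_apply S A V]
  have : Algebra.IsIntegral S (IsLocalRing.ResidueField V) :=
    Algebra.IsIntegral.of_surjective
      (IsScalarTower.toAlgHom S V (IsLocalRing.ResidueField V)) IsLocalRing.residue_surjective
  rw [isValuativeDomain_iff_residueField K (V := V) fun v hv => Subalgebra.mem_bot_of_tower S (h v hv)]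
  exact isSimplyMinimal_of_isIntegral_tower ((isValuativeDomain_iff_residueField K h).1 hS)

end Extension

/-! ### Rings between `R` and its integral closure -/

theorem Subalgebra.isFractionRing_of_isFractionRing {R V K : Type*} [CommRing R] [CommRing V]
    [Field K] [Algebra R V] [Algebra V K] [Algebra R K] [IsScalarTower R V K] [IsFractionRing R K]
    [FaithfulSMul V K] (A : Subalgebra R V) : IsFractionRing A K := by
  have : FaithfulSMul A K := by
    rw [faithfulSMul_iff_algebraMap_injective]
    exact (FaithfulSMul.algebraMap_injective V K).comp Subtype.val_injective
  refine IsFractionRing.of_field A K fun z => ?_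
  obtain ⟨a, b, -, rfl⟩ := IsFractionRing.div_surjective (A := R) z
  refine ⟨algebraMap R A a, algebraMap R A b, ?_⟩
  rw [IsScalarTower.algebraMap_apply R V K, IsScalarTower.algebraMap_apply R V K]
  rfl

section IntegralClosure

variable {R V : Type*} [CommRing R] [CommRing V] [IsDomain V] [Algebra R V]

theorem Subalgebra.mem_of_mem_isPrime (K : Type*) [Field K] [Algebra V K] [Algebra R K]
    [IsScalarTower R V K] [IsFractionRing R K] [IsFractionRing V K] [Algebra.IsIntegral R V]
    {A : Subalgebra R V} (hA : IsPseudoValuationDomain A)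
    {Q : Ideal V} (hQ : Q.IsPrime) {v : V} (hv : v ∈ Q) : v ∈ A := by
  have : IsFractionRing A K := A.isFractionRing_of_isFractionRing
  have : Algebra.IsIntegral A V := Algebra.IsIntegral.tower_top R
  obtain ⟨a, rfl⟩ := Algebra.mem_bot.1 (hA.mem_bot_of_mem_isPrime K hQ hv)
  exact a.2

theorem isValuativeDomain_of_le (K : Type*) [Field K] [Algebra V K] [Algebra R K]
    [IsScalarTower R V K] [IsFractionRing R K] [IsFractionRing V K] [Algebra.IsIntegral R V]
    [ValuationRing V] {S A : Subalgebra R V} (hSA : S ≤ A)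
    (hS : IsValuativeDomain S) (h : ∀ v ∈ IsLocalRing.maximalIdeal V, v ∈ S) :
    IsValuativeDomain A := by
  have : IsFractionRing A K := A.isFractionRing_of_isFractionRing
  have : IsFractionRing S K := S.isFractionRing_of_isFractionRing
  have : Algebra.IsIntegral S V := Algebra.IsIntegral.tower_top R
  let _ : Algebra S A := (Subalgebra.inclusion hSA).toRingHom.toAlgebra
  have : IsScalarTower S A V := IsScalarTower.of_algebraMap_eq fun _ => rfl
  exact hS.of_tower K (V := V) fun v hv => Algebra.mem_bot.2 ⟨⟨v, h v hv⟩, rfl⟩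

theorem IsPseudoValuationDomain.valuationRing_of_top [IsIntegrallyClosed V]
    (h : IsPseudoValuationDomain (⊤ : Subalgebra R V))
    (hv : IsValuativeDomain (⊤ : Subalgebra R V)) : ValuationRing V := by
  let e : (⊤ : Subalgebra R V) ≃ₐ[R] V := Subalgebra.topEquiv
  have : IsIntegrallyClosed (⊤ : Subalgebra R V) := IsIntegrallyClosed.of_equiv e.symm.toRingEquiv
  have := h.valuationRing_of_isValuativeDomain hv
  exact e.surjective.valuationRing (f := e.toRingEquiv.toRingHom)

variable (R V) in
theorem isMaximalNonValuativeSubring_iff [IsDomain R] (K : Type*) [Field K] [Algebra V K] [Algebra R K]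
    [IsScalarTower R V K] [IsFractionRing R K] [IsFractionRing V K] [Algebra.IsIntegral R V]
    [IsIntegrallyClosed V] [FaithfulSMul R V]
    (hR : IsMaximalNonPseudoValuationSubring R V) :
    IsMaximalNonValuativeSubring R V ↔
      (¬ IsValuativeDomain R ∧ ValuationRing V ∧
        ∃ S : Subalgebra R V, IsUniqueMinimalOverring S ∧ IsValuativeDomain S) := by
  obtain ⟨hne, hnot, hpvd⟩ := hR
  constructor
  · rintro ⟨-, hnv, hval⟩
    have htop : (⊥ : Subalgebra R V) < ⊤ := bot_lt_iff_ne_bot.2 hne.symm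
    have hV : ValuationRing V := (hpvd ⊤ htop).valuationRing_of_top (hval ⊤ htop)
    -- If this were `R`, the maximal ideal would lie in `R`, making `R` pseudo-valuation.
    let S := Algebra.adjoin R (IsLocalRing.maximalIdeal V : Set V)
    have hS : ⊥ < S := by
      refine bot_lt_iff_ne_bot.2 fun h => hnot (isPseudoValuationDomain_of_maximalIdeal_le K
        (V := V) fun v hv => ?_)
      exact h ▸ Algebra.subset_adjoin hv
    refine ⟨hnv, hV, S, ⟨hS, fun A hA => Algebra.adjoin_le fun v hv => ?_⟩, hval S hS⟩
    exact Subalgebra.mem_of_mem_isPrime K (hpvd A (bot_lt_iff_ne_bot.2 hA))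
      (IsLocalRing.maximalIdeal.isMaximal V).isPrime hv
  · rintro ⟨hnv, hV, S, ⟨hS, hmin⟩, hSv⟩
    refine ⟨hne, hnv, fun A hA => isValuativeDomain_of_le K (hmin A hA.ne') hSv fun v hv => ?_⟩
    exact Subalgebra.mem_of_mem_isPrime K (hpvd S hS)
      (IsLocalRing.maximalIdeal.isMaximal V).isPrime hv

end IntegralClosure

theorem theorem2p13 (R : Type*) [CommRing R] [IsDomain R]
    (hR : IsMaximalNonPseudoValuationSubring R (integralClosure R (FractionRing R))) :
    IsMaximalNonValuativeSubring R (integralClosure R (FractionRing R)) ↔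
      (¬ IsValuativeDomain R ∧ ValuationRing (integralClosure R (FractionRing R)) ∧
        ∃ S : Subalgebra R (integralClosure R (FractionRing R)),
          IsUniqueMinimalOverring S ∧ IsValuativeDomain S) := by
  have : IsFractionRing (integralClosure R (FractionRing R)) (FractionRing R) :=
    integralClosure.isFractionRing_of_finite_extension (FractionRing R) (FractionRing R)
  have : IsIntegrallyClosed (integralClosure R (FractionRing R)) :=
    integralClosure.isIntegrallyClosedOfFiniteExtension (FractionRing R)
  exact isMaximalNonValuativeSubring_iff R _ (FractionRing R) hR
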